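/- Let $\sigma=\mathrm{Prop}\cup\{R_i\mid i\in I\}$ be a signature with a finite set $\mathrm{Prop}$ of unary proposition letters and binary actions $R_i$ indexed by a finite set $I$. A $\sigma$-LTS $M_a$ is a (possibly infinite) $\sigma$-structure $M$ with a distinguished state $a$. It is image-finite if every state $m$ has only finitely many successors, i.e. states $n$ with $R_i^M(m,n)$ for some $i\in I$; it is point-generated if every state is reachable from $a$ by a directed path (possibly of length $0$) of transitions. Homomorphisms and isomorphisms of $\sigma$-LTSs preserve distinguished states. Let $\mathcal{PG}_\sigma$ be the class of finite point-generated $\sigma$-LTSs, and let $\mathrm{hom}_{\mathbb N}(T_c,M_a)$ be the number of homomorphisms from $T_c$ to $M_a$. Let $\mathtt{gsub}(M_a)$ be the smallest substructure of $M$ that contains $a$ and is closed under successors, with distinguished state $a$. Nominal-free hybrid logic $\mathrm{HL}(\downarrow,@)$ has the formulas $$\varphi ::= p\mid x\mid \varphi\land\varphi\mid\varphi\lor\varphi\mid\lnot\varphi\mid\Diamond_i\varphi\mid\square_i\varphi\mid\;\downarrow x.\varphi\mid @_x\varphi,$$ with $p\in\mathrm{Prop}$, $i\in I$, and $x$ from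 a countably infinite set of world variables. Under an assignment $g$ of states to world variables, the propositional, Boolean and modal clauses are as usual, and $M_m,g\models x$ iff $g(x)=m$; $M_m,g\models\;\downarrow x.\varphi$ iff $M_m,g[x\mapsto m]\models\varphi$; $M_m,g\models @_x\varphi$ iff $M_{g(x)},g\models\varphi$. A sentence is a formula without free world variables, where $\downarrow x$ binds $x$; its truth in $M_a$ does not depend on $g$. Let $M_a$ and $N_b$ be image-finite $\sigma$-LTSs. Then for every $T_c\in\mathcal{PG}_\sigma$ there are only finitely many homomorphisms from $T_c$ to $M_a$ and from $T_c$ to $N_b$, and the following are equivalent: 1. $\mathrm{hom}_{\mathbb N}(T_c,M_a)=\mathrm{hom}_{\mathbb N}(T_c,N_b)$ for all $T_c\in\mathcal{PG}_\sigma$; 2. $\mathtt{gsub}(M_a)\cong\mathtt{gsub}(N_b)$; 3. $M_a$ and $N_b$ satisfy the same sentences of $\mathrm{HL}(\downarrow,@)$. -/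

import Mathlib

universe uP uI u v w

/-- A labeled transition system over the modal signature with proposition letters `P` and
actions indexed by `I`: a structure with a distinguished state `pt`. -/
structure LTS (P : Type uP) (I : Type uI) where
  State : Type u
  val : P → State → Prop
  rel : I → State → State → Prop
  pt : State

namespace LTS

variable {P : Type uP} {I : Type uI}

/-- `m` has a transition to `n` along some action. -/
def Step (M : LTS.{uP, uI, u} P I) (m n : M.State) : Prop := ∃ i, M.rel i m n

/-- The set of successors of a state, along all actions. -/
def succ (M : LTS.{uP, uI, u} P I) (m : M.State) : Set M.State := {n | M.Step m n}

def ImageFinite (M : LTS.{uP, uI, u} P I) : Prop := ∀ m, (M.succ m).Finite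

/-- Every state is reached from the distinguished one by a directed path, possibly of length 0. -/
def PointGenerated (M : LTS.{uP, uI, u} P I) : Prop :=
  ∀ m, Relation.ReflTransGen M.Step M.pt m

/-- The class of finite point-generated LTSs. -/
def PG (P : Type uP) (I : Type uI) : Set (LTS.{uP, uI, w} P I) :=
  {T | Finite T.State ∧ T.PointGenerated}

/-- Homomorphisms of LTSs; they preserve the distinguished state. -/
structure Hom (M : LTS.{uP, uI, u} P I) (N : LTS.{uP, uI, v} P I) where
  toFun : M.State → N.State
  map_pt : toFun M.pt = N.pt
  map_val : ∀ p m, M.val p m → N.val p (toFun m)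
  map_rel : ∀ i m n, M.rel i m n → N.rel i (toFun m) (toFun n)

/-- Existence of an isomorphism: a homomorphism with a homomorphism as two-sided inverse. -/
def Isomorphic (M : LTS.{uP, uI, u} P I) (N : LTS.{uP, uI, v} P I) : Prop :=
  ∃ (f : Hom M N) (g : Hom N M),
    Function.LeftInverse g.toFun f.toFun ∧ Function.RightInverse g.toFun f.toFun

/-- The homomorphism count over a semiring `S`: the unit of `S` added to itself as many times as
there are homomorphisms. Meaningful when there are only finitely many. -/
noncomputable def homCount (S : Type*) [Semiring S]
    (T : LTS.{uP, uI, w} P I) (M : LTS.{uP, uI, u} P I) : S :=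
  Nat.card (Hom T M) • (1 : S)

/-- The left homomorphism vector of `M` over `S`, restricted to the class `C`. -/
noncomputable def leftProfile (S : Type*) [Semiring S]
    (C : Set (LTS.{uP, uI, w} P I)) (M : LTS.{uP, uI, u} P I) : C → S :=
  fun T => homCount S T.1 M

/-- The domain of the generated submodel: the smallest set of states that contains the
distinguished one and is closed under transitions. -/
def genSet (M : LTS.{uP, uI, u} P I) : Set M.State :=
  ⋂₀ {X | M.pt ∈ X ∧ ∀ b ∈ X, ∀ i c, M.rel i b c → c ∈ X}

/-- The submodel generated by the distinguished state. -/
def gsub (M : LTS.{uP, uI, u} P I) : LTS.{uP, uI, u} P I where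
  State := M.genSet
  val p m := M.val p m
  rel i m n := M.rel i m n
  pt := ⟨M.pt, fun _ hX => hX.1⟩

end LTS

/-- Formulas of nominal-free hybrid logic with `↓` and `@`; world variables are natural numbers. -/
inductive HLFormula (P : Type uP) (I : Type uI) where
  | prop : P → HLFormula P I
  | wvar : ℕ → HLFormula P I
  | and : HLFormula P I → HLFormula P I → HLFormula P I
  | or : HLFormula P I → HLFormula P I → HLFormula P I
  | not : HLFormula P I → HLFormula P I
  | dia : I → HLFormula P I → HLFormula P I
  | box : I → HLFormula P I → HLFormula P I
  | down : ℕ → HLFormula P I → HLFormula P I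
  | atVar : ℕ → HLFormula P I → HLFormula P I

namespace HLFormula

variable {P : Type uP} {I : Type uI}

/-- The free world variables. -/
def free : HLFormula P I → Set ℕ
  | prop _ => ∅
  | wvar x => {x}
  | and φ ψ => φ.free ∪ ψ.free
  | or φ ψ => φ.free ∪ ψ.free
  | not φ => φ.free
  | dia _ φ => φ.free
  | box _ φ => φ.free
  | down x φ => φ.free \ {x}
  | atVar x φ => insert x φ.free

def IsSentence (φ : HLFormula P I) : Prop := φ.free = ∅

/-- Satisfaction at the state `m` under the assignment `g`. -/
def Sat (M : LTS.{uP, uI, u} P I) : (ℕ → M.State) → M.State → HLFormula P I → Prop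
  | _, m, prop p => M.val p m
  | g, m, wvar x => g x = m
  | g, m, and φ ψ => Sat M g m φ ∧ Sat M g m ψ
  | g, m, or φ ψ => Sat M g m φ ∨ Sat M g m ψ
  | g, m, not φ => ¬ Sat M g m φ
  | g, m, dia i φ => ∃ n, M.rel i m n ∧ Sat M g n φ
  | g, m, box i φ => ∀ n, M.rel i m n → Sat M g n φ
  | g, m, down x φ => Sat M (Function.update g x m) m φ
  | g, _, atVar x φ => Sat M g (g x) φ

theorem sat_congr (M : LTS.{uP, uI, u} P I) (φ : HLFormula P I) :
    ∀ (g h : ℕ → M.State) (m : M.State), (∀ x ∈ φ.free, g x = h x) →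
      (Sat M g m φ ↔ Sat M h m φ) := by
  induction φ with
  | prop p => intro g h m _; rfl
  | wvar x => intro g h m H; simp only [Sat, H x rfl]
  | and φ ψ ih₁ ih₂ =>
    intro g h m H
    simp only [Sat, ih₁ g h m (fun x hx => H x (Or.inl hx)),
      ih₂ g h m (fun x hx => H x (Or.inr hx))]
  | or φ ψ ih₁ ih₂ =>
    intro g h m H
    simp only [Sat, ih₁ g h m (fun x hx => H x (Or.inl hx)),
      ih₂ g h m (fun x hx => H x (Or.inr hx))]
  | not φ ih => intro g h m H; simp only [Sat, ih g h m H]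
  | dia i φ ih => intro g h m H; simp only [Sat, ih g h _ H]
  | box i φ ih => intro g h m H; simp only [Sat, ih g h _ H]
  | down x φ ih =>
    intro g h m H
    refine ih _ _ m (fun y hy => ?_)
    by_cases hyx : y = x
    · subst hyx; simp
    · simpa [Function.update_of_ne hyx] using H y ⟨hy, hyx⟩
  | atVar x φ ih =>
    intro g h m H
    simp only [Sat, H x (Or.inl rfl)]
    exact ih g h _ (fun y hy => H y (Or.inr hy))

/-- Truth of a sentence at the distinguished state. -/
def Holds (M : LTS.{uP, uI, u} P I) (φ : HLFormula P I) : Prop :=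
  ∀ g : ℕ → M.State, Sat M g M.pt φ

/-- For sentences the assignment does not matter. -/
theorem holds_iff (M : LTS.{uP, uI, u} P I) (φ : HLFormula P I) (hφ : φ.IsSentence)
    (g : ℕ → M.State) : Holds M φ ↔ Sat M g M.pt φ := by
  refine ⟨fun H => H g, fun H h => (sat_congr M φ g h M.pt ?_).1 H⟩
  intro x hx
  rw [show φ.free = ∅ from hφ] at hx
  exact hx.elim

end HLFormula

/-- Equivalence of LTSs with respect to sentences of nominal-free hybrid logic. -/
def HLEquiv {P : Type uP} {I : Type uI}
    (M : LTS.{uP, uI, u} P I) (N : LTS.{uP, uI, v} P I) : Prop :=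
  ∀ φ : HLFormula P I, φ.IsSentence → (φ.Holds M ↔ φ.Holds N)

/-! Conditions 1 and 3 each imply that every ball of radius `d` around one distinguished state maps
injectively into the other structure, in both directions. Balls are finite by image-finiteness and
homomorphisms respect them, so balls of equal radius are isomorphic; compactness then yields an
isomorphism of generated submodels (`gsub_isomorphic_of_injective`). From counts: sorting
homomorphisms by kernel and inducting on the size of `T` recovers the number of injective ones,
which is positive for a ball of `M` because of its inclusion. From logic: name the states of a ball
by variables one at a time, matching each new successor in `N`. If none of its finitely many
candidates matched, one formula would refute them all (`Agree.exists_update`). Conversely,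
point-generated tests and sentences see only the generated submodel. -/

namespace LTS

variable {P : Type uP} {I : Type uI}

/-! ### Homomorphisms and mutual embeddings -/

section Basic

variable {M : LTS.{uP, uI, u} P I} {N : LTS.{uP, uI, v} P I} {T : LTS.{uP, uI, w} P I}

theorem Hom.toFun_injective : Function.Injective (Hom.toFun : Hom M N → M.State → N.State) := by
  rintro ⟨f, _, _, _⟩ ⟨g, _, _, _⟩ h
  cases h
  rfl

def Hom.id (M : LTS.{uP, uI, u} P I) : Hom M M :=
  ⟨fun m => m, rfl, fun _ _ h => h, fun _ _ _ h => h⟩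

def Hom.comp (g : Hom M N) (f : Hom T M) : Hom T N where
  toFun t := g.toFun (f.toFun t)
  map_pt := by rw [f.map_pt, g.map_pt]
  map_val p _ h := g.map_val p _ (f.map_val p _ h)
  map_rel i _ _ h := g.map_rel i _ _ (f.map_rel i _ _ h)

theorem Hom.exists_iterate (f : Hom M M) (n : ℕ) : ∃ h : Hom M M, h.toFun = f.toFun^[n] := by
  induction n with
  | zero => exact ⟨Hom.id M, rfl⟩
  | succ n ih =>
    obtain ⟨h, hh⟩ := ih
    exact ⟨h.comp f, by rw [Function.iterate_succ, ← hh]; rfl⟩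

theorem Isomorphic.symm (h : Isomorphic M N) : Isomorphic N M := by
  obtain ⟨f, g, h₁, h₂⟩ := h
  exact ⟨g, f, h₂, h₁⟩

/-- Finite structures with injective homomorphisms in both directions are isomorphic. -/
theorem isomorphic_of_injective_of_injective [Finite M.State] (f : Hom M N) (g : Hom N M)
    (hf : Function.Injective f.toFun) (hg : Function.Injective g.toFun) : Isomorphic M N := by
  have hinj : Function.Injective (g.comp f).toFun := hg.comp hf
  let e : Equiv.Perm M.State := Equiv.ofBijective _ (Finite.injective_iff_bijective.1 hinj)
  obtain ⟨n, hn, he⟩ := (isOfFinOrder_of_finite e).exists_pow_eq_one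
  obtain ⟨k, rfl⟩ : ∃ k, n = k + 1 := ⟨n - 1, by omega⟩
  have hfix : ∀ m, (g.comp f).toFun^[k + 1] m = m := fun m => by
    have h := congrArg (fun σ : Equiv.Perm M.State => σ m) he
    rw [Equiv.Perm.coe_pow] at h
    exact h
  -- Since `g ∘ f` has order dividing `k + 1`, the inverse of `f` is `(g ∘ f)^k ∘ g`.
  obtain ⟨h, hh⟩ := (g.comp f).exists_iterate k
  refine ⟨f, h.comp g, fun m => ?_, fun n => hg ?_⟩
  · change h.toFun ((g.comp f).toFun m) = m
    rw [hh, ← Function.iterate_succ_apply, hfix]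
  · change (g.comp f).toFun (h.toFun (g.toFun n)) = g.toFun n
    rw [hh, ← Function.iterate_succ_apply' (g.comp f).toFun, hfix]

end Basic

/-! ### Finite balls around the distinguished state -/

section Ball

/-- The states reached from the distinguished one in at most `d` transitions. -/
def ballSet (M : LTS.{uP, uI, u} P I) : ℕ → Set M.State
  | 0 => {M.pt}
  | d + 1 => M.ballSet d ∪ ⋃ m ∈ M.ballSet d, M.succ m

variable (M : LTS.{uP, uI, u} P I) (N : LTS.{uP, uI, v} P I)

theorem ballSet_mono : Monotone M.ballSet :=
  monotone_nat_of_le_succ fun _ => Set.subset_union_left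

theorem pt_mem_ballSet (d : ℕ) : M.pt ∈ M.ballSet d :=
  M.ballSet_mono (Nat.zero_le d) rfl

variable {M N}

theorem mem_ballSet_succ {d : ℕ} {m n : M.State} (hm : m ∈ M.ballSet d) (h : M.Step m n) :
    n ∈ M.ballSet (d + 1) :=
  Or.inr (Set.mem_biUnion hm h)

theorem ImageFinite.finite_ballSet (hM : M.ImageFinite) (d : ℕ) : (M.ballSet d).Finite := by
  induction d with
  | zero => exact Set.finite_singleton _
  | succ d ih => exact ih.union (ih.biUnion fun m _ => hM m)

theorem exists_mem_ballSet {m : M.State} (h : Relation.ReflTransGen M.Step M.pt m) :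
    ∃ d, m ∈ M.ballSet d := by
  induction h with
  | refl => exact ⟨0, rfl⟩
  | tail _ h ih =>
    obtain ⟨d, hd⟩ := ih
    exact ⟨d + 1, mem_ballSet_succ hd h⟩

theorem reflTransGen_of_mem_ballSet {d : ℕ} {m : M.State} (h : m ∈ M.ballSet d) :
    Relation.ReflTransGen M.Step M.pt m := by
  induction d generalizing m with
  | zero => cases h; exact .refl
  | succ d ih =>
    rcases h with h | h
    · exact ih h
    · obtain ⟨n, hn, h⟩ := Set.mem_iUnion₂.1 h
      exact (ih hn).tail h

theorem mem_genSet_iff {m : M.State} : m ∈ M.genSet ↔ ∃ d, m ∈ M.ballSet d := by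
  constructor
  · intro h
    refine h {m | ∃ d, m ∈ M.ballSet d} ⟨⟨0, rfl⟩, ?_⟩
    rintro b ⟨d, hd⟩ i c hc
    exact ⟨d + 1, mem_ballSet_succ hd ⟨i, hc⟩⟩
  · rintro ⟨d, hd⟩ X ⟨hpt, hX⟩
    induction d generalizing m with
    | zero => cases hd; exact hpt
    | succ d ih =>
      rcases hd with hd | hd
      · exact ih hd
      · obtain ⟨n, hn, i, h⟩ := Set.mem_iUnion₂.1 hd
        exact hX n (ih hn) i m h

theorem Hom.map_mem_ballSet (f : Hom M N) {d : ℕ} {m : M.State} (h : m ∈ M.ballSet d) :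
    f.toFun m ∈ N.ballSet d := by
  induction d generalizing m with
  | zero => cases h; exact f.map_pt
  | succ d ih =>
    rcases h with h | h
    · exact Or.inl (ih h)
    · obtain ⟨n, hn, i, h⟩ := Set.mem_iUnion₂.1 h
      exact mem_ballSet_succ (ih hn) ⟨i, f.map_rel i _ _ h⟩

/-- Each state has a finite ball of `N` in which its image must lie, so homomorphisms form a subset
of a finite product. -/
theorem Hom.finite_of_imageFinite [Finite M.State] (hM : M.PointGenerated) (hN : N.ImageFinite) :
    Finite (Hom M N) := by
  choose d hd using fun m => exists_mem_ballSet (hM m)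
  have hfin : (Set.univ.pi fun m => N.ballSet (d m)).Finite :=
    Set.Finite.pi fun m => hN.finite_ballSet (d m)
  have : Finite (Set.univ.pi fun m => N.ballSet (d m)) := hfin
  exact Finite.of_injective
    (fun f : Hom M N => (⟨f.toFun, fun m _ => f.map_mem_ballSet (hd m)⟩ :
      Set.univ.pi fun m => N.ballSet (d m)))
    fun f g h => Hom.toFun_injective (congrArg Subtype.val h)

/-- The submodel on the states reached in at most `d` transitions. -/
def ball (M : LTS.{uP, uI, u} P I) (d : ℕ) : LTS.{uP, uI, u} P I where
  State := M.ballSet d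
  val p m := M.val p m
  rel i m n := M.rel i m n
  pt := ⟨M.pt, M.pt_mem_ballSet d⟩

def ballInclusion (M : LTS.{uP, uI, u} P I) (d : ℕ) : Hom (M.ball d) M where
  toFun m := m.1
  map_pt := rfl
  map_val _ _ h := h
  map_rel _ _ _ h := h

/-- A path of length at most `d` never leaves the ball, so it survives the restriction. -/
theorem mem_ballSet_ball {d k : ℕ} (hk : k ≤ d) {m : M.State} (h : m ∈ M.ballSet k) :
    (⟨m, M.ballSet_mono hk h⟩ : (M.ball d).State) ∈ (M.ball d).ballSet k := by
  induction k generalizing m with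
  | zero => cases h; exact rfl
  | succ k ih =>
    rcases h with h | h
    · exact Or.inl (ih (by omega) h)
    · obtain ⟨n, hn, i, h⟩ := Set.mem_iUnion₂.1 h
      exact mem_ballSet_succ (ih (by omega) hn) ⟨i, h⟩

theorem ball_pointGenerated (d : ℕ) : (M.ball d).PointGenerated := fun m =>
  reflTransGen_of_mem_ballSet (mem_ballSet_ball le_rfl m.2)

theorem Hom.exists_ball (d : ℕ) (f : Hom (M.ball d) N) (hf : Function.Injective f.toFun) :
    ∃ f' : Hom (M.ball d) (N.ball d), Function.Injective f'.toFun :=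
  ⟨{ toFun := fun m => ⟨f.toFun m, f.map_mem_ballSet (mem_ballSet_ball le_rfl m.2)⟩
     map_pt := Subtype.ext f.map_pt
     map_val := fun p m h => f.map_val p m h
     map_rel := fun i m n h => f.map_rel i m n h },
    fun _ _ h => hf (congrArg Subtype.val h)⟩

end Ball

/-! ### Compactness: gluing isomorphisms of balls -/

section Limit

open Filter

variable {M : LTS.{uP, uI, u} P I} {N : LTS.{uP, uI, v} P I}

/-- A choice of homomorphisms between the balls of two models, as maps on all states. -/
noncomputable def extendBallHom (f : ∀ d, Hom (M.ball d) (N.ball d)) (d : ℕ) (m : M.State) :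
    N.State :=
  -- The default is harmless: a state of the generated submodel lies in all large balls.
  open Classical in if h : m ∈ M.ballSet d then ((f d).toFun ⟨m, h⟩).1 else N.pt

theorem extendBallHom_of_mem (f : ∀ d, Hom (M.ball d) (N.ball d)) {d : ℕ} {m : M.State}
    (h : m ∈ M.ballSet d) : extendBallHom f d m = ((f d).toFun ⟨m, h⟩).1 := dif_pos h

theorem eventually_mem_ballSet {m : M.State} (hm : m ∈ M.genSet) :
    ∀ᶠ d in (hyperfilter ℕ : Filter ℕ), m ∈ M.ballSet d := by
  obtain ⟨k, hk⟩ := mem_genSet_iff.1 hm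
  have : ∀ᶠ d in atTop, m ∈ M.ballSet d :=
    (eventually_ge_atTop k).mono fun d hd => M.ballSet_mono hd hk
  exact Nat.hyperfilter_le_atTop this

/-- The images of a state of the `k`-ball all lie in the finite `k`-ball of `N`, so the ultrafilter
selects one value. -/
theorem exists_eventually_extendBallHom_eq (hN : N.ImageFinite)
    (f : ∀ d, Hom (M.ball d) (N.ball d)) (m : M.gsub.State) :
    ∃ n : N.gsub.State, ∀ᶠ d in (hyperfilter ℕ : Filter ℕ), extendBallHom f d m.1 = n.1 := by
  obtain ⟨k, hk⟩ := mem_genSet_iff.1 m.2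
  have h : ∀ᶠ d in (hyperfilter ℕ : Filter ℕ), ∃ n ∈ N.ballSet k, extendBallHom f d m.1 = n := by
    refine Nat.hyperfilter_le_atTop ((eventually_ge_atTop k).mono fun d hd => ⟨_, ?_, rfl⟩)
    rw [extendBallHom_of_mem f (M.ballSet_mono hd hk)]
    exact ((N.ballInclusion d).comp (f d)).map_mem_ballSet (mem_ballSet_ball hd hk)
  obtain ⟨n, hn, h⟩ := (Ultrafilter.eventually_exists_mem_iff (hN.finite_ballSet k)).1 h
  exact ⟨⟨n, mem_genSet_iff.2 ⟨k, hn⟩⟩, h⟩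

/-- A limit of homomorphisms between balls along an ultrafilter. -/
theorem exists_gsub_hom (hN : N.ImageFinite) (f : ∀ d, Hom (M.ball d) (N.ball d)) :
    ∃ F : Hom M.gsub N.gsub, ∀ m : M.gsub.State,
      ∀ᶠ d in (hyperfilter ℕ : Filter ℕ), extendBallHom f d m.1 = (F.toFun m).1 := by
  choose F hF using exists_eventually_extendBallHom_eq hN f
  -- Each condition involves at most two states, so it can be read off at a single suitable `d`.
  refine ⟨⟨F, ?_, fun p m h => ?_, fun i m n h => ?_⟩, hF⟩
  · obtain ⟨d, hd⟩ := (hF M.gsub.pt).exists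
    refine Subtype.ext (hd.symm.trans ?_)
    exact (extendBallHom_of_mem f (M.pt_mem_ballSet d)).trans
      (congrArg Subtype.val (f d).map_pt)
  · obtain ⟨d, hd, hm⟩ := ((hF m).and (eventually_mem_ballSet m.2)).exists
    rw [extendBallHom_of_mem f hm] at hd
    change N.val p (F m).1
    rw [← hd]
    exact (f d).map_val p ⟨m.1, hm⟩ h
  · obtain ⟨d, ⟨hd, hm⟩, hd', hn⟩ := (((hF m).and (eventually_mem_ballSet m.2)).and
      ((hF n).and (eventually_mem_ballSet n.2))).exists
    rw [extendBallHom_of_mem f hm] at hd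
    rw [extendBallHom_of_mem f hn] at hd'
    change N.rel i (F m).1 (F n).1
    rw [← hd, ← hd']
    exact (f d).map_rel i ⟨m.1, hm⟩ ⟨n.1, hn⟩ h

theorem leftInverse_of_eventually {f : ∀ d, Hom (M.ball d) (N.ball d)}
    {g : ∀ d, Hom (N.ball d) (M.ball d)}
    (hfg : ∀ d, Function.LeftInverse (g d).toFun (f d).toFun)
    {F : Hom M.gsub N.gsub} {G : Hom N.gsub M.gsub}
    (hF : ∀ m : M.gsub.State,
      ∀ᶠ d in (hyperfilter ℕ : Filter ℕ), extendBallHom f d m.1 = (F.toFun m).1)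
    (hG : ∀ n : N.gsub.State,
      ∀ᶠ d in (hyperfilter ℕ : Filter ℕ), extendBallHom g d n.1 = (G.toFun n).1) :
    Function.LeftInverse G.toFun F.toFun := fun m => by
  obtain ⟨d, ⟨h₁, h₂⟩, hm⟩ :=
    (((hF m).and (hG (F.toFun m))).and (eventually_mem_ballSet m.2)).exists
  refine Subtype.ext (h₂.symm.trans ?_)
  rw [← h₁, extendBallHom_of_mem f hm, extendBallHom_of_mem g ((f d).toFun ⟨m.1, hm⟩).2]
  exact congrArg Subtype.val (hfg d ⟨m.1, hm⟩)

theorem gsub_isomorphic_of_ball (hM : M.ImageFinite) (hN : N.ImageFinite)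
    (h : ∀ d, Isomorphic (M.ball d) (N.ball d)) : Isomorphic M.gsub N.gsub := by
  choose f g hgf hfg using h
  obtain ⟨F, hF⟩ := exists_gsub_hom hN f
  obtain ⟨G, hG⟩ := exists_gsub_hom hM g
  exact ⟨F, G, leftInverse_of_eventually hgf hF hG, leftInverse_of_eventually hfg hG hF⟩

theorem gsub_isomorphic_of_injective (hM : M.ImageFinite) (hN : N.ImageFinite)
    (hMN : ∀ d, ∃ f : Hom (M.ball d) N, Function.Injective f.toFun)
    (hNM : ∀ d, ∃ f : Hom (N.ball d) M, Function.Injective f.toFun) :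
    Isomorphic M.gsub N.gsub := by
  refine gsub_isomorphic_of_ball hM hN fun d => ?_
  obtain ⟨f, hf⟩ := hMN d
  obtain ⟨g, hg⟩ := hNM d
  obtain ⟨f', hf'⟩ := f.exists_ball d hf
  obtain ⟨g', hg'⟩ := g.exists_ball d hg
  have : Finite (M.ball d).State := hM.finite_ballSet d
  exact isomorphic_of_injective_of_injective f' g' hf' hg'

end Limit

/-! ### From homomorphism counts to injective homomorphisms -/

section Counting

variable {M : LTS.{uP, uI, u} P I} {N : LTS.{uP, uI, v} P I}

/-- The homomorphic image of `T` on the classes of an equivalence relation. -/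
def quot (T : LTS.{uP, uI, w} P I) (s : Setoid T.State) : LTS.{uP, uI, w} P I where
  State := Quotient s
  val p q := ∃ t, Quotient.mk s t = q ∧ T.val p t
  rel i q r := ∃ t t', Quotient.mk s t = q ∧ Quotient.mk s t' = r ∧ T.rel i t t'
  pt := Quotient.mk s T.pt

def quotMk (T : LTS.{uP, uI, w} P I) (s : Setoid T.State) : Hom T (T.quot s) where
  toFun := Quotient.mk s
  map_pt := rfl
  map_val _ t h := ⟨t, rfl, h⟩
  map_rel _ t t' h := ⟨t, t', rfl, rfl, h⟩

theorem quot_mem_PG {T : LTS.{uP, uI, w} P I} (hT : T ∈ PG P I) (s : Setoid T.State) :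
    T.quot s ∈ PG P I := by
  have := hT.1
  refine ⟨inferInstanceAs (Finite (Quotient s)), fun q => ?_⟩
  induction q using Quotient.inductionOn with
  | h t => exact (hT.2 t).lift (Quotient.mk s) fun a b ⟨i, h⟩ => ⟨i, a, b, rfl, rfl, h⟩

/-- Homomorphisms with kernel `s` are the injective homomorphisms of the quotient by `s`. -/
def kerEquiv (T : LTS.{uP, uI, w} P I) (M : LTS.{uP, uI, u} P I) (s : Setoid T.State) :
    {f : Hom T M // Setoid.ker f.toFun = s} ≃
      {f : Hom (T.quot s) M // Function.Injective f.toFun} where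
  toFun f := ⟨{
      toFun := Quotient.lift f.1.toFun fun a b h => by
        have h' : (Setoid.ker f.1.toFun) a b := by rw [f.2]; exact h
        exact h'
      map_pt := f.1.map_pt
      map_val := by
        rintro p _ ⟨t, rfl, h⟩
        exact f.1.map_val p t h
      map_rel := by
        rintro i _ _ ⟨t, t', rfl, rfl, h⟩
        exact f.1.map_rel i t t' h }, by
    intro a b
    induction a using Quotient.inductionOn
    induction b using Quotient.inductionOn
    intro h
    refine Quotient.sound ?_
    have h' : (Setoid.ker f.1.toFun) _ _ := h
    rw [f.2] at h'
    exact h'⟩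
  invFun f := ⟨f.1.comp (T.quotMk s), by
    ext a b
    exact f.2.eq_iff.trans Quotient.eq⟩
  left_inv f := rfl
  right_inv f := by
    refine Subtype.ext (Hom.toFun_injective (funext fun q => ?_))
    induction q using Quotient.inductionOn
    rfl

theorem card_hom_eq_sum (T : LTS.{uP, uI, w} P I) (M : LTS.{uP, uI, u} P I)
    [Fintype (Setoid T.State)] [Finite (Hom T M)] :
    Nat.card (Hom T M) =
      ∑ s : Setoid T.State, Nat.card {f : Hom T M // Setoid.ker f.toFun = s} := by
  rw [← Nat.card_sigma]
  exact (Nat.card_congr (Equiv.sigmaFiberEquiv fun f : Hom T M => Setoid.ker f.toFun)).symm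

theorem card_ker_bot (T : LTS.{uP, uI, w} P I) (M : LTS.{uP, uI, u} P I) :
    Nat.card {f : Hom T M // Setoid.ker f.toFun = ⊥} =
      Nat.card {f : Hom T M // Function.Injective f.toFun} :=
  Nat.card_congr (Equiv.subtypeEquivRight fun f => Setoid.injective_iff_ker_bot f.toFun |>.symm)

theorem card_quot_lt (T : LTS.{uP, uI, w} P I) [Finite T.State] {s : Setoid T.State}
    (hs : s ≠ ⊥) : Nat.card (T.quot s).State < Nat.card T.State := by
  refine lt_of_le_of_ne (Nat.card_le_card_of_surjective _ (Quotient.mk_surjective (s := s)))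
    fun h => hs ?_
  have hbij := (Nat.bijective_iff_surjective_and_card (Quotient.mk s)).2
    ⟨Quotient.mk_surjective, h.symm⟩
  refine eq_bot_iff.2 fun a b hab => hbij.1 (Quotient.sound hab)

/-- Equal homomorphism counts from all point-generated structures give equal counts of injective
homomorphisms. -/
theorem card_injective_eq_of_card_eq (hM : M.ImageFinite) (hN : N.ImageFinite)
    (h : ∀ T ∈ PG.{uP, uI, w} P I, Nat.card (Hom T M) = Nat.card (Hom T N))
    (T : LTS.{uP, uI, w} P I) (hT : T ∈ PG P I) :
    Nat.card {f : Hom T M // Function.Injective f.toFun} =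
      Nat.card {f : Hom T N // Function.Injective f.toFun} := by
  induction hn : Nat.card T.State using Nat.strong_induction_on generalizing T with
  | _ n ih =>
  classical
  subst hn
  have := hT.1
  have : Finite (Setoid T.State) :=
    Finite.of_injective (fun s : Setoid T.State => (s : T.State → T.State → Prop))
      fun s t h => Setoid.ext fun a b => by rw [show s a b = t a b from congrFun₂ h a b]
  have := Fintype.ofFinite (Setoid T.State)
  have := Hom.finite_of_imageFinite hT.2 hM
  have := Hom.finite_of_imageFinite hT.2 hN
  -- The kernel `⊥` contributes the injective homomorphisms; all other terms come from strictly
  -- smaller quotients and cancel by induction.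
  have key := h T hT
  rw [card_hom_eq_sum, card_hom_eq_sum, ← Finset.add_sum_erase _ _ (Finset.mem_univ ⊥),
    ← Finset.add_sum_erase _ _ (Finset.mem_univ ⊥),
    Finset.sum_congr rfl fun s hs => ?_, Nat.add_right_cancel_iff, card_ker_bot,
    card_ker_bot] at key
  · exact key
  · rw [Nat.card_congr (kerEquiv T M s), Nat.card_congr (kerEquiv T N s)]
    exact ih _ (T.card_quot_lt (Finset.ne_of_mem_erase hs)) _ (quot_mem_PG hT s) rfl

/-- A copy of a structure along a bijection of the states. -/
def transport (M : LTS.{uP, uI, u} P I) {α : Type w} (e : α ≃ M.State) : LTS.{uP, uI, w} P I where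
  State := α
  val p a := M.val p (e a)
  rel i a b := M.rel i (e a) (e b)
  pt := e.symm M.pt

theorem transport_isomorphic (M : LTS.{uP, uI, u} P I) {α : Type w} (e : α ≃ M.State) :
    Isomorphic (M.transport e) M :=
  ⟨⟨e, e.apply_symm_apply _, fun _ _ h => h, fun _ _ _ h => h⟩,
    ⟨e.symm, rfl, fun p m h => by simpa [transport] using h,
      fun i m n h => by simpa [transport] using h⟩,
    e.symm_apply_apply, e.apply_symm_apply⟩

theorem Isomorphic.pointGenerated (h : Isomorphic M N) (hM : M.PointGenerated) :
    N.PointGenerated := fun n => by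
  obtain ⟨f, g, -, hfg⟩ := h
  have : Relation.ReflTransGen N.Step (f.toFun M.pt) (f.toFun (g.toFun n)) :=
    (hM (g.toFun n)).lift f.toFun fun a b ⟨i, h⟩ => ⟨i, f.map_rel i a b h⟩
  rwa [f.map_pt, hfg n] at this

theorem exists_injective_of_card_eq (hM : M.ImageFinite) (hN : N.ImageFinite)
    (h : ∀ T ∈ PG.{uP, uI, w} P I, Nat.card (Hom T M) = Nat.card (Hom T N)) (d : ℕ) :
    ∃ f : Hom (M.ball d) N, Function.Injective f.toFun := by
  have := hM.finite_ballSet d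
  have : Finite (M.ball d).State := this
  -- The ball may live in another universe than the test structures, so it is copied.
  let e : ULift.{w} (Fin (Nat.card (M.ball d).State)) ≃ (M.ball d).State :=
    Equiv.ulift.trans (Finite.equivFin _).symm
  have hiso := (M.ball d).transport_isomorphic e
  have hT : (M.ball d).transport e ∈ PG.{uP, uI, w} P I :=
    ⟨inferInstanceAs (Finite (ULift (Fin _))), hiso.symm.pointGenerated (ball_pointGenerated d)⟩
  obtain ⟨f, g, hgf, hfg⟩ := hiso
  have : Finite ((M.ball d).transport e).State := hT.1
  have := Hom.finite_of_imageFinite hT.2 hM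
  have := Hom.finite_of_imageFinite hT.2 hN
  have hne : Nonempty {f : Hom ((M.ball d).transport e) M // Function.Injective f.toFun} :=
    ⟨(M.ballInclusion d).comp f, Subtype.val_injective.comp hgf.injective⟩
  have hpos := Nat.card_pos_iff.2 ⟨hne, inferInstance⟩
  rw [card_injective_eq_of_card_eq hM hN h _ hT] at hpos
  obtain ⟨k, hk⟩ := (Nat.card_pos_iff.1 hpos).1
  exact ⟨k.comp g, hk.comp hfg.injective⟩

end Counting

/-! ### Counts depend only on the generated submodel -/

section Gsub

variable {M : LTS.{uP, uI, u} P I} {N : LTS.{uP, uI, v} P I} {T : LTS.{uP, uI, w} P I}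

theorem mem_genSet_of_rel {i : I} {m n : M.State} (hm : m ∈ M.genSet) (h : M.rel i m n) :
    n ∈ M.genSet := fun X hX => hX.2 m (hm X hX) i n h

def gsubInclusion (M : LTS.{uP, uI, u} P I) : Hom M.gsub M where
  toFun m := m.1
  map_pt := rfl
  map_val _ _ h := h
  map_rel _ _ _ h := h

/-- Homomorphisms from a point-generated structure take values in the generated submodel. -/
def homGsubEquiv (hT : T.PointGenerated) : Hom T M ≃ Hom T M.gsub where
  toFun f :=
    { toFun := fun t => ⟨f.toFun t, mem_genSet_iff.2
        ((exists_mem_ballSet (hT t)).imp fun _ h => f.map_mem_ballSet h)⟩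
      map_pt := Subtype.ext f.map_pt
      map_val := fun p t h => f.map_val p t h
      map_rel := fun i t t' h => f.map_rel i t t' h }
  invFun f := M.gsubInclusion.comp f
  left_inv _ := rfl
  right_inv _ := rfl

theorem Isomorphic.card_hom_eq (h : Isomorphic M N) (T : LTS.{uP, uI, w} P I) :
    Nat.card (Hom T M) = Nat.card (Hom T N) := by
  obtain ⟨f, g, hgf, hfg⟩ := h
  exact Nat.card_congr ⟨f.comp, g.comp,
    fun k => Hom.toFun_injective (funext fun t => hgf (k.toFun t)),
    fun k => Hom.toFun_injective (funext fun t => hfg (k.toFun t))⟩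

theorem card_hom_eq_of_gsub_isomorphic (h : Isomorphic M.gsub N.gsub) (hT : T.PointGenerated) :
    Nat.card (Hom T M) = Nat.card (Hom T N) := by
  rw [Nat.card_congr (homGsubEquiv (M := M) hT), Nat.card_congr (homGsubEquiv (M := N) hT)]
  exact h.card_hom_eq T

theorem leftProfile_nat_eq_iff :
    leftProfile ℕ (PG.{uP, uI, w} P I) M = leftProfile ℕ (PG.{uP, uI, w} P I) N ↔
      ∀ T ∈ PG.{uP, uI, w} P I, Nat.card (Hom T M) = Nat.card (Hom T N) := by
  simp [funext_iff, leftProfile, homCount]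

end Gsub

end LTS

/-! ### Hybrid logic: invariance and matching of tuples -/

namespace HLFormula

open LTS

variable {P : Type uP} {I : Type uI} {M : LTS.{uP, uI, u} P I} {N : LTS.{uP, uI, v} P I}

/-- Satisfaction is invariant under embeddings onto successor-closed sets of states. -/
theorem sat_iff_of_embedding (f : M.State → N.State) (hf : Function.Injective f)
    (hval : ∀ p m, M.val p m ↔ N.val p (f m))
    (hrel : ∀ i m n, M.rel i m n ↔ N.rel i (f m) (f n))
    (hsucc : ∀ i m n, N.rel i (f m) n → ∃ m', f m' = n) (φ : HLFormula P I) :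
    ∀ (g : ℕ → M.State) (m : M.State), Sat M g m φ ↔ Sat N (f ∘ g) (f m) φ := by
  induction φ with
  | prop p => exact fun g m => hval p m
  | wvar x => exact fun g m => hf.eq_iff.symm
  | and φ ψ ih₁ ih₂ => exact fun g m => and_congr (ih₁ g m) (ih₂ g m)
  | or φ ψ ih₁ ih₂ => exact fun g m => or_congr (ih₁ g m) (ih₂ g m)
  | not φ ih => exact fun g m => not_congr (ih g m)
  | dia i φ ih =>
    refine fun g m => ⟨?_, ?_⟩
    · rintro ⟨n, hn, h⟩
      exact ⟨f n, (hrel i m n).1 hn, (ih g n).1 h⟩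
    · rintro ⟨n, hn, h⟩
      obtain ⟨n, rfl⟩ := hsucc i m n hn
      exact ⟨n, (hrel i m n).2 hn, (ih g n).2 h⟩
  | box i φ ih =>
    refine fun g m => ⟨fun h n hn => ?_, fun h n hn => (ih g n).2 (h _ ((hrel i m n).1 hn))⟩
    obtain ⟨n, rfl⟩ := hsucc i m n hn
    exact (ih g n).1 (h n ((hrel i m n).2 hn))
  | down x φ ih =>
    intro g m
    rw [Sat, Sat, ih, Function.comp_update]
  | atVar x φ ih => exact fun g m => ih g (g x)

theorem hlEquiv_of_embedding (f : M.State → N.State) (hf : Function.Injective f)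
    (hpt : f M.pt = N.pt)
    (hval : ∀ p m, M.val p m ↔ N.val p (f m))
    (hrel : ∀ i m n, M.rel i m n ↔ N.rel i (f m) (f n))
    (hsucc : ∀ i m n, N.rel i (f m) n → ∃ m', f m' = n) : HLEquiv M N := fun φ hφ => by
  rw [holds_iff M φ hφ fun _ => M.pt, holds_iff N φ hφ (f ∘ fun _ => M.pt),
    sat_iff_of_embedding f hf hval hrel hsucc, hpt]

theorem hlEquiv_gsub (M : LTS.{uP, uI, u} P I) : HLEquiv M.gsub M :=
  hlEquiv_of_embedding (fun m : M.gsub.State => m.1) Subtype.val_injective rfl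
    (fun _ _ => Iff.rfl) (fun _ _ _ => Iff.rfl)
    fun _ m n h => ⟨⟨n, mem_genSet_of_rel m.2 h⟩, rfl⟩

theorem hlEquiv_of_isomorphic (h : Isomorphic M N) : HLEquiv M N := by
  obtain ⟨f, g, hgf, hfg⟩ := h
  refine hlEquiv_of_embedding f.toFun hgf.injective f.map_pt
    (fun p m => ⟨f.map_val p m, fun h => ?_⟩) (fun i m n => ⟨f.map_rel i m n, fun h => ?_⟩)
    fun _ _ n _ => ⟨g.toFun n, hfg n⟩
  · simpa only [hgf m] using g.map_val p _ h
  · simpa only [hgf m, hgf n] using g.map_rel i _ _ h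

theorem hlEquiv_of_gsub_isomorphic (h : Isomorphic M.gsub N.gsub) : HLEquiv M N := fun φ hφ =>
  ((hlEquiv_gsub M φ hφ).symm.trans (hlEquiv_of_isomorphic h φ hφ)).trans (hlEquiv_gsub N φ hφ)

/-- The tuples given by the first `l` values of two assignments satisfy the same formulas. -/
def Agree (M : LTS.{uP, uI, u} P I) (N : LTS.{uP, uI, v} P I) (l : ℕ)
    (g : ℕ → M.State) (h : ℕ → N.State) : Prop :=
  ∀ φ : HLFormula P I, φ.free ⊆ Set.Iio l → (Sat M g (g 0) φ ↔ Sat N h (h 0) φ)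

theorem agree_one_of_hlEquiv (H : HLEquiv M N) :
    Agree M N 1 (fun _ => M.pt) (fun _ => N.pt) := fun φ hφ => by
  have hs : (down 0 φ).IsSentence :=
    Set.sdiff_eq_empty.2 fun x hx => Nat.lt_one_iff.1 (hφ hx)
  have := H _ hs
  rwa [holds_iff M _ hs fun _ => M.pt, holds_iff N _ hs fun _ => N.pt, Sat, Sat,
    Function.update_eq_self, Function.update_eq_self] at this

/-- Finitely many tuples that do not agree with a given one are refuted by a single formula. -/
theorem exists_sat_forall_not_sat {l : ℕ} (hl : 0 < l) {g : ℕ → M.State}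
    (h : N.State → ℕ → N.State) {S : Set N.State} (hS : S.Finite)
    (hne : ∀ n ∈ S, ¬ Agree M N l g (h n)) :
    ∃ ψ : HLFormula P I, ψ.free ⊆ Set.Iio l ∧ Sat M g (g 0) ψ ∧
      ∀ n ∈ S, ¬ Sat N (h n) (h n 0) ψ := by
  induction S, hS using Set.Finite.induction_on with
  | empty =>
    -- The formula `wvar 0` plays the role of truth: it holds at `g 0`.
    refine ⟨wvar 0, ?_, rfl, fun n hn => hn.elim⟩
    rintro _ rfl
    exact hl
  | @insert a S _ _ ih =>
    obtain ⟨ψ, hψ, hsat, hnot⟩ := ih fun n hn => hne n (Or.inr hn)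
    obtain ⟨χ, hχ, hχM, hχN⟩ : ∃ χ : HLFormula P I, χ.free ⊆ Set.Iio l ∧ Sat M g (g 0) χ ∧
        ¬ Sat N (h a) (h a 0) χ := by
      have := hne a (Or.inl rfl)
      simp only [Agree, not_forall] at this
      obtain ⟨χ, hχ, hiff⟩ := this
      by_cases hM : Sat M g (g 0) χ
      · exact ⟨χ, hχ, hM, fun hN => hiff ⟨fun _ => hN, fun _ => hM⟩⟩
      · exact ⟨not χ, hχ, hM, fun hN => hiff ⟨fun h => absurd h hM, fun h => absurd h hN⟩⟩
    refine ⟨and ψ χ, Set.union_subset hψ hχ, ⟨hsat, hχM⟩, ?_⟩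
    rintro n (rfl | hn) ⟨h₁, h₂⟩
    · exact hχN h₂
    · exact hnot n hn h₁

theorem Agree.exists_update (hN : N.ImageFinite) {l : ℕ} (hl : 0 < l) {g : ℕ → M.State}
    {h : ℕ → N.State} (H : Agree M N l g h) {k : ℕ} (hk : k < l) {i : I} {m : M.State}
    (hm : M.rel i (g k) m) :
    ∃ n, Agree M N (l + 1) (Function.update g l m) (Function.update h l n) := by
  by_contra! hcon
  obtain ⟨ψ, hψ, hsat, hnot⟩ := exists_sat_forall_not_sat (Nat.succ_pos l)
    (fun n => Function.update h l n) (hN (h k)) fun n _ => hcon n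
  -- Go to the `k`-th state, take a successor, name it `l`, and return to variable `0`, where
  -- `Agree` evaluates.
  have hfree : (atVar k (dia i (down l (atVar 0 ψ)))).free ⊆ Set.Iio l := by
    rintro x (rfl | ⟨rfl | hx, hxl⟩)
    · exact hk
    · exact hl
    · exact lt_of_le_of_ne (Nat.lt_succ_iff.1 (hψ hx)) hxl
  obtain ⟨n, hn, hn'⟩ := (H _ hfree).1 ⟨m, hm, hsat⟩
  exact hnot n ⟨i, hn⟩ hn'

/-- Walk along a path to `m`, appending each visited state to the tuple; the first `l` values on the
side of `M` stay fixed. -/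
theorem Agree.exists_mem (hN : N.ImageFinite) {m : M.State}
    (hm : Relation.ReflTransGen M.Step M.pt m) {l : ℕ} {g : ℕ → M.State} {h : ℕ → N.State}
    (hl : 0 < l) (hg : g 0 = M.pt) (H : Agree M N l g h) :
    ∃ l' g' h', l ≤ l' ∧ (∀ x < l, g' x = g x) ∧ h' 0 = h 0 ∧ Agree M N l' g' h' ∧
      ∃ k < l', g' k = m := by
  induction hm with
  | refl => exact ⟨l, g, h, le_rfl, fun _ _ => rfl, rfl, H, 0, hl, hg⟩
  | tail _ hstep ih =>
    obtain ⟨l', g', h', hle, hgg', hh, H', k, hk, rfl⟩ := ih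
    obtain ⟨i, hi⟩ := hstep
    obtain ⟨n, hn⟩ := H'.exists_update hN (hl.trans_le hle) hk hi
    refine ⟨l' + 1, _, _, hle.trans (Nat.le_succ _), fun x hx => ?_, ?_, hn, l',
      Nat.lt_succ_self _, Function.update_self ..⟩
    · rw [Function.update_of_ne (hx.trans_le hle).ne, hgg' x hx]
    · rw [Function.update_of_ne (hl.trans_le hle).ne, hh]

theorem exists_agree_of_finite (hN : N.ImageFinite) (H : HLEquiv M N) {S : Set M.State}
    (hS : S.Finite) (hreach : ∀ m ∈ S, Relation.ReflTransGen M.Step M.pt m) :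
    ∃ l g h, 0 < l ∧ g 0 = M.pt ∧ h 0 = N.pt ∧ Agree M N l g h ∧ ∀ m ∈ S, ∃ k < l, g k = m := by
  induction S, hS using Set.Finite.induction_on with
  | empty =>
    exact ⟨1, _, _, Nat.one_pos, rfl, rfl, agree_one_of_hlEquiv H, fun m hm => hm.elim⟩
  | @insert a S _ _ ih =>
    obtain ⟨l, g, h, hl, hg, hpt, hag, hcov⟩ := ih fun m hm => hreach m (Or.inr hm)
    obtain ⟨l', g', h', hle, hgg', hh, hag', ha⟩ :=
      hag.exists_mem hN (hreach a (Or.inl rfl)) hl hg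
    refine ⟨l', g', h', hl.trans_le hle, (hgg' 0 hl).trans hg, hh.trans hpt, hag', ?_⟩
    rintro m (rfl | hm)
    · exact ha
    · obtain ⟨k, hk, rfl⟩ := hcov m hm
      exact ⟨k, hk.trans_le hle, hgg' k hk⟩

theorem exists_injective_of_hlEquiv (hM : M.ImageFinite) (hN : N.ImageFinite) (H : HLEquiv M N)
    (d : ℕ) : ∃ f : Hom (M.ball d) N, Function.Injective f.toFun := by
  obtain ⟨l, g, h, hl, hg, hpt, hag, hcov⟩ := exists_agree_of_finite hN H
    (hM.finite_ballSet d) fun m hm => reflTransGen_of_mem_ballSet hm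
  choose k hk hgk using fun m : (M.ball d).State => hcov m.1 m.2
  -- Forwards this preserves the distinguished state; backwards it gives injectivity.
  have heq : ∀ x < l, ∀ y < l, (g x = g y ↔ h x = h y) := fun x hx y hy =>
    hag (atVar y (wvar x)) (by rintro z (rfl | rfl) <;> assumption)
  refine ⟨⟨fun m => h (k m), ?_, fun p m hp => ?_, fun i m n hr => ?_⟩, fun m n hmn => ?_⟩
  · rw [← hpt]
    exact (heq _ (hk _) 0 hl).1 ((hgk _).trans hg.symm)
  · refine (hag (atVar (k m) (prop p)) ?_).1 ?_
    · rintro z (rfl | hz)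
      exacts [hk m, hz.elim]
    · change M.val p (g (k m))
      rw [hgk]
      exact hp
  · have hsat : Sat M g (g 0) (atVar (k m) (dia i (wvar (k n)))) :=
      ⟨g (k n), by rw [hgk, hgk]; exact hr, rfl⟩
    obtain ⟨n', hn', heq'⟩ := (hag _ (by rintro z (rfl | rfl) <;> apply hk)).1 hsat
    cases heq'
    exact hn'
  · refine Subtype.ext ?_
    rw [← hgk m, ← hgk n]
    exact (heq _ (hk m) _ (hk n)).2 hmn

end HLFormula

theorem HLEquiv.symm {P : Type uP} {I : Type uI} {M : LTS.{uP, uI, u} P I}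
    {N : LTS.{uP, uI, v} P I} (h : HLEquiv M N) : HLEquiv N M := fun φ hφ => (h φ hφ).symm

theorem mainTheorem2 {P : Type uP} {I : Type uI} [Finite P] [Finite I]
    (M : LTS.{uP, uI, u} P I) (N : LTS.{uP, uI, v} P I)
    (hM : M.ImageFinite) (hN : N.ImageFinite) :
    (∀ T ∈ LTS.PG.{uP, uI, w} P I, Finite (LTS.Hom T M) ∧ Finite (LTS.Hom T N)) ∧
    List.TFAE [
      LTS.leftProfile ℕ (LTS.PG.{uP, uI, w} P I) M = LTS.leftProfile ℕ (LTS.PG.{uP, uI, w} P I) N,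
      LTS.Isomorphic M.gsub N.gsub,
      HLEquiv M N] := by
  refine ⟨fun T hT => ?_, ?_⟩
  · have := hT.1
    exact ⟨LTS.Hom.finite_of_imageFinite hT.2 hM, LTS.Hom.finite_of_imageFinite hT.2 hN⟩
  · rw [LTS.leftProfile_nat_eq_iff]
    tfae_have 1 → 2 := fun h => LTS.gsub_isomorphic_of_injective hM hN
      (LTS.exists_injective_of_card_eq hM hN h)
      (LTS.exists_injective_of_card_eq hN hM fun T hT => (h T hT).symm)
    tfae_have 2 → 1 := fun h T hT => LTS.card_hom_eq_of_gsub_isomorphic h hT.2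
    tfae_have 2 → 3 := HLFormula.hlEquiv_of_gsub_isomorphic
    tfae_have 3 → 2 := fun h => LTS.gsub_isomorphic_of_injective hM hN
      (HLFormula.exists_injective_of_hlEquiv hM hN h)
      (HLFormula.exists_injective_of_hlEquiv hN hM h.symm)
    tfae_finish
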